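/- **Conventions.** For $g\in L^2(\mathbb R)$ and $z=x+iy\in\mathbb C$ put $g_z(t)=e^{-2\pi i y t}g(t-x)$, $k_z(w)=\langle g_z,g_w\rangle$ and $k(w)=k_0(w)=\langle g,g_w\rangle$. The Feichtinger algebra $\mathcal A$ is the set of $g\in L^2(\mathbb R)$ with $k\in L^1(\mathbb C)$ (Lebesgue measure $m$). The model space of $g$ is $H_g=\{F\in L^2(\mathbb C):\ \exists f\in L^2(\mathbb R),\ F(z)=\langle f,g_z\rangle\ \forall z\}$, with the norm of $L^2(\mathbb C)$. A set $\Gamma\subset\mathbb C$ is uniformly discrete if for some $\varepsilon>0$ all distinct $z,w\in\Gamma$ satisfy $|z-w|>\varepsilon$. It is a sampling set for $H_g$ if there are $A,B>0$ with $A\|F\|^2\le\sum_{\gamma\in\Gamma}|F(\gamma)|^2\le B\|F\|^2$ for all $F\in H_g$. The Gabor system $G(g,\Gamma)=\{g_z\}_{z\in\Gamma}$ is a frame of $L^2(\mathbb R)$ if there are $A,B>0$ with $A\|f\|^2\le\sum_{z\in\Gamma}|\langle f,g_z\rangle|^2\le B\|f\|^2$ for all $f\in L^2(\mathbb R)$.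 Let $MF(z)=\sup_{|w-z|<1}|F(w)|$, and for $\delta>0$ let $q(\delta)\ge 0$ be given by $$q(\delta)^2=\Bigl(\sup_{|z|\le\delta}\int_{\mathbb C}|k_z(w)-k(w)|\,dm(w)\Bigr)\bigl(\|k\|_1+\|Mk\|_1\bigr).$$ **Theorem.** Let $g\in\mathcal A$ with $\|g\|=1$. 1. There is $\delta>0$ such that every uniformly discrete $\Gamma\subset\mathbb C$ with $B(z,\delta)\cap\Gamma\neq\emptyset$ for all $z\in\mathbb C$ is a sampling set for $H_g$, and $G(g,\Gamma)$ is a frame of $L^2(\mathbb R)$. 2. Explicitly: there is $\delta\in(0,1]$ with $q(\delta)<1$. Moreover, let $\delta\in(0,1]$ be any number with $q=q(\delta)<1$, let $\alpha>0$, and let $\Gamma\subset\mathbb C$ satisfy $|z-w|\ge\alpha$ for all distinct $z,w\in\Gamma$ and $B(z,\delta)\cap\Gamma\ne\emptyset$ for all $z\in\mathbb C$. Then there are pairwise disjoint open sets $V_\gamma$ ($\gamma\in\Gamma$) with $\bigcup_\gamma\overline{V_\gamma}=\mathbb C$, $m(\mathbb C\setminus\bigcup_\gamma V_\gamma)=0$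 and $B(\gamma,\alpha/2)\subseteq V_\gamma\subseteq B(\gamma,\delta)$ for all $\gamma$. For every such family, with $c_\gamma=m(V_\gamma)$, $$(1-q)^2\|F\|^2\le\sum_{\gamma\in\Gamma}c_\gamma|F(\gamma)|^2\le(1+q)^2\|F\|^2\qquad\text{for all }F\in H_g,$$ and consequently $$\frac{(1-q)^2}{\pi\delta^2}\|F\|^2\le\sum_{\gamma\in\Gamma}|F(\gamma)|^2\le\frac{(1+q)^2}{\pi(\alpha/2)^2}\|F\|^2\qquad\text{for all }F\in H_g.$$ -/

import Mathlib

open MeasureTheory Metric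
open scoped ENNReal

noncomputable section

/-- The Hilbert space `L²(ℝ)` of complex-valued functions. -/
abbrev L2R : Type := Lp ℂ 2 (volume : Measure ℝ)

theorem memLp_gaborAtom (g : L2R) (z : ℂ) :
    MemLp (fun t : ℝ => Complex.exp (-2 * Real.pi * Complex.I * z.im * t) * g (t - z.re)) 2
      volume := by
  have h1 : MemLp (fun t : ℝ => g (t - z.re)) 2 volume :=
    (Lp.memLp g).comp_measurePreserving (measurePreserving_sub_right volume z.re)
  refine h1.of_le ?_ ?_
  · refine AEStronglyMeasurable.mul ?_ h1.1
    exact Continuous.aestronglyMeasurable (by fun_prop)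
  · refine Filter.Eventually.of_forall fun t => ?_
    have h2 : (-2 * Real.pi * Complex.I * z.im * t : ℂ)
        = ((-2 * Real.pi * z.im * t : ℝ) : ℂ) * Complex.I := by
      push_cast
      ring
    rw [norm_mul, h2, Complex.norm_exp_ofReal_mul_I, one_mul]

/-- The time-frequency shift `g_z(t) = e^{-2π i y t} g(t - x)`, `z = x + i y`, in `L²(ℝ)`. -/
def gaborAtom (g : L2R) (z : ℂ) : L2R :=
  (memLp_gaborAtom g z).toLp _

/-- The Gabor transform `G f(z) = ⟨f, g_z⟩ = ∫ f(t) conj(g_z(t)) dt`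
(Mathlib's inner product is conjugate-linear in its first argument). -/
def gaborTransform (g f : L2R) (z : ℂ) : ℂ :=
  inner ℂ (gaborAtom g z) f

/-- The reproducing kernel `k_{z₀}(z) = ⟨g_{z₀}, g_z⟩`. -/
def gaborKernel (g : L2R) (z₀ z : ℂ) : ℂ :=
  gaborTransform g (gaborAtom g z₀) z

/-- The Feichtinger algebra: all `g ∈ L²(ℝ)` such that `k(z) = ⟨g, g_z⟩` is in `L¹(ℂ)`. -/
def feichtingerAlgebra : Set L2R :=
  {g | Integrable (fun z : ℂ => gaborTransform g g z) volume}

/-- The model space `H_g`: all `F ∈ L²(ℂ)` with `F(z) = ⟨f, g_z⟩` for some `f ∈ L²(ℝ)`. -/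
def modelSpace (g : L2R) : Set (ℂ → ℂ) :=
  {F | MemLp F 2 volume ∧ ∃ f : L2R, ∀ z, F z = gaborTransform g f z}

/-- The squared norm of `L²(ℂ)`. -/
def normSqL2 (F : ℂ → ℂ) : ℝ := ∫ z, ‖F z‖ ^ 2

/-- `Γ` is a sampling set for `H_g`. -/
def IsSamplingSet (g : L2R) (Γ : Set ℂ) : Prop :=
  ∃ A B : ℝ, 0 < A ∧ 0 < B ∧ ∀ F ∈ modelSpace g,
    Summable (fun γ : Γ => ‖F γ‖ ^ 2) ∧
    A * normSqL2 F ≤ ∑' γ : Γ, ‖F γ‖ ^ 2 ∧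
    ∑' γ : Γ, ‖F γ‖ ^ 2 ≤ B * normSqL2 F

/-- The family `e` is a frame of the Hilbert space `H`. -/
def IsHilbertFrame {ι H : Type*} [NormedAddCommGroup H] [InnerProductSpace ℂ H]
    (e : ι → H) : Prop :=
  ∃ A B : ℝ, 0 < A ∧ 0 < B ∧ ∀ f : H,
    Summable (fun i => ‖inner ℂ (e i) f‖ ^ 2) ∧
    A * ‖f‖ ^ 2 ≤ ∑' i, ‖inner ℂ (e i) f‖ ^ 2 ∧
    ∑' i, ‖inner ℂ (e i) f‖ ^ 2 ≤ B * ‖f‖ ^ 2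

/-- The Gabor system `G(g, Γ) = {g_z : z ∈ Γ}`. -/
def gaborSystem (g : L2R) (Γ : Set ℂ) : Γ → L2R := fun z => gaborAtom g z

/-- `Γ` is uniformly discrete. -/
def IsUniformlyDiscrete (Γ : Set ℂ) : Prop :=
  ∃ ε : ℝ, 0 < ε ∧ ∀ z ∈ Γ, ∀ w ∈ Γ, z ≠ w → ε < ‖z - w‖

/-- The local maximal function `M F(z) = sup_{|w - z| < 1} |F(w)|`. -/
def localMaximal (F : ℂ → ℂ) (z : ℂ) : ℝ≥0∞ :=
  ⨆ w ∈ ball z 1, ‖F w‖ₑ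

/-- `sup_{|z| ≤ δ} ∫ |k_z(w) - k(w)| dm(w)`. -/
def kernelOscillation (g : L2R) (δ : ℝ) : ℝ≥0∞ :=
  ⨆ z ∈ closedBall (0 : ℂ) δ, ∫⁻ w, ‖gaborKernel g z w - gaborTransform g g w‖ₑ

/-- The number `q² = (sup_{|z| ≤ δ} ∫ |k_z - k| dm) * (‖k‖₁ + ‖M k‖₁)`. -/
def deviationSq (g : L2R) (δ : ℝ) : ℝ≥0∞ :=
  kernelOscillation g δ *
    ((∫⁻ w, ‖gaborTransform g g w‖ₑ) + ∫⁻ w, localMaximal (gaborTransform g g) w)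

/-- The number `q` itself. -/
def deviation (g : L2R) (δ : ℝ) : ℝ := Real.sqrt (deviationSq g δ).toReal

/-- A partition of `ℂ`, up to a null set, into open cells `V γ` around the points `γ` of `Γ`,
each of them between the discs of radii `α / 2` and `δ` about `γ`. -/
structure IsCellPartition (Γ : Set ℂ) (α δ : ℝ) (V : Γ → Set ℂ) : Prop where
  isOpen : ∀ γ, IsOpen (V γ)
  disjoint : ∀ γ γ', γ ≠ γ' → Disjoint (V γ) (V γ')
  closure_cover : ⋃ γ, closure (V γ) = Set.univ
  null_compl : volume (⋃ γ, V γ)ᶜ = 0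
  ball_subset : ∀ γ : Γ, ball (γ : ℂ) (α / 2) ⊆ V γ
  subset_ball : ∀ γ : Γ, V γ ⊆ ball (γ : ℂ) δ

end

/-! ### Time-frequency shifts -/

/-! For `‖g‖ = 1` the orthogonality relations (`lintegral_gaborTransform_sq`, Plancherel in the
modulation variable) make `f ↦ ⟨f, g_z⟩` an isometry into `L²(ℂ)`. Hence norms in `H_g` and in
`L²(ℝ)` agree, and inner products in `L²(ℝ)` become integrals over `ℂ`: the reproducing formula.

Given cells `V γ`, compare `F` with the function `E` equal on `V γ` to `F γ` times a unimodular
phase, so that `‖E‖²` is the weighted sum of samples. With the right phase, `|F - E|` at `z ∈ V γ`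
is at most the integral of `|F(w)|` against `|k_{z-γ}(w-γ) - k(w-γ)|`. Schur's test bounds this
operator: integrating in `w` gives the oscillation of the kernel, while integrating in `z` over all
cells gives at most `‖k‖₁ + ‖Mk‖₁`, because `|z-γ| < δ ≤ 1`. Thus `‖F - E‖ ≤ q‖F‖`, and the triangle
inequality gives the weighted bounds. Comparing the areas of Voronoi cells with those of the inner
and outer discs removes the weights.

That `q < 1` for small `δ` rests on `Mk ∈ L¹` (`lintegral_localMaximal_lt_top`): averaging the
shifts of `g` over a small disc gives a window whose transform of `g` is locally controlled by
integrals of `|k|`, and the reproducing formula for that window bounds `Mk` by a convolution of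
integrable functions. Dominated convergence with majorant `2Mk` then makes the oscillation tend to
zero. -/

theorem coeFn_gaborAtom (g : L2R) (z : ℂ) :
    gaborAtom g z =ᵐ[volume]
      fun t : ℝ => Complex.exp (-2 * Real.pi * Complex.I * z.im * t) * g (t - z.re) :=
  MemLp.coeFn_toLp _

theorem norm_exp_modulation (y t : ℝ) :
    ‖Complex.exp (-2 * Real.pi * Complex.I * y * t)‖ = 1 := by
  have h2 : (-2 * Real.pi * Complex.I * y * t : ℂ)
      = ((-2 * Real.pi * y * t : ℝ) : ℂ) * Complex.I := by
    push_cast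
    ring
  rw [h2, Complex.norm_exp_ofReal_mul_I]

theorem norm_gaborAtom (g : L2R) (z : ℂ) : ‖gaborAtom g z‖ = ‖g‖ := by
  rw [gaborAtom, Lp.norm_toLp, Lp.norm_def]
  congr 1
  rw [← eLpNorm_comp_measurePreserving (Lp.aestronglyMeasurable g)
    (measurePreserving_sub_right volume z.re)]
  refine eLpNorm_congr_norm_ae (Filter.Eventually.of_forall fun t => ?_)
  simp only [norm_mul, norm_exp_modulation, one_mul, Function.comp_apply]

theorem ae_comp_sub {p : ℝ → Prop} (h : ∀ᵐ t, p t) (x : ℝ) : ∀ᵐ t : ℝ, p (t - x) :=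
  (measurePreserving_sub_right volume x).quasiMeasurePreserving.ae h

theorem gaborAtom_add (f g : L2R) (z : ℂ) :
    gaborAtom (f + g) z = gaborAtom f z + gaborAtom g z := by
  refine Lp.ext ?_
  filter_upwards [coeFn_gaborAtom (f + g) z, coeFn_gaborAtom f z, coeFn_gaborAtom g z,
    Lp.coeFn_add (gaborAtom f z) (gaborAtom g z), ae_comp_sub (Lp.coeFn_add f g) z.re]
    with t h1 h2 h3 h4 h5
  rw [h1, h4, Pi.add_apply, h2, h3, h5, Pi.add_apply, mul_add]

theorem gaborAtom_smul (c : ℂ) (f : L2R) (z : ℂ) :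
    gaborAtom (c • f) z = c • gaborAtom f z := by
  refine Lp.ext ?_
  filter_upwards [coeFn_gaborAtom (c • f) z, coeFn_gaborAtom f z,
    Lp.coeFn_smul c (gaborAtom f z), ae_comp_sub (Lp.coeFn_smul c f) z.re]
    with t h1 h2 h3 h4
  rw [h1, h3, Pi.smul_apply, h2, h4, Pi.smul_apply, smul_eq_mul, smul_eq_mul]
  ring

/-- The time-frequency shift by `z` as a linear isometry of `L²(ℝ)`. -/
noncomputable def gaborShift (z : ℂ) : L2R →ₗᵢ[ℂ] L2R where
  toFun f := gaborAtom f z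
  map_add' f g := gaborAtom_add f g z
  map_smul' c f := gaborAtom_smul c f z
  norm_map' f := norm_gaborAtom f z

theorem inner_gaborAtom_gaborAtom (f g : L2R) (z : ℂ) :
    inner ℂ (gaborAtom f z) (gaborAtom g z) = inner ℂ f g :=
  (gaborShift z).inner_map_map f g

theorem gaborAtom_sub (f g : L2R) (z : ℂ) :
    gaborAtom (f - g) z = gaborAtom f z - gaborAtom g z :=
  (gaborShift z).map_sub f g

theorem gaborAtom_zero (g : L2R) : gaborAtom g 0 = g := by
  refine Lp.ext ?_
  filter_upwards [coeFn_gaborAtom g 0] with t h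
  rw [h]
  simp

/-- The phase relating the composition of two time-frequency shifts to the shift by the sum. -/
noncomputable def shiftPhase (z w : ℂ) : ℂ :=
  Complex.exp (-2 * Real.pi * Complex.I * w.im * ((-z.re : ℝ) : ℂ))

theorem norm_shiftPhase (z w : ℂ) : ‖shiftPhase z w‖ = 1 := norm_exp_modulation _ _

theorem gaborAtom_gaborAtom (g : L2R) (z w : ℂ) :
    gaborAtom (gaborAtom g w) z = shiftPhase z w • gaborAtom g (z + w) := by
  refine Lp.ext ?_
  filter_upwards [coeFn_gaborAtom (gaborAtom g w) z, coeFn_gaborAtom g (z + w),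
    Lp.coeFn_smul (shiftPhase z w) (gaborAtom g (z + w)),
    ae_comp_sub (coeFn_gaborAtom g w) z.re] with t h1 h2 h3 h4
  rw [h1, h3, Pi.smul_apply, h2, h4, smul_eq_mul, shiftPhase, ← mul_assoc, ← mul_assoc,
    ← Complex.exp_add, ← Complex.exp_add, Complex.add_re, sub_sub, Complex.add_im]
  congr 2
  push_cast
  ring

/-- The inner product is the Fourier integral of an `L¹` function, so dominated convergence applies.
-/
theorem continuous_inner_modulation (f h : L2R) :
    Continuous fun y : ℝ => inner ℂ f (gaborAtom h (y * Complex.I)) := by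
  have key : (fun y : ℝ => inner ℂ f (gaborAtom h (y * Complex.I))) = fun y : ℝ =>
      ∫ t : ℝ, Complex.exp (-2 * Real.pi * Complex.I * y * t) * inner ℂ (f t) (h t) := by
    funext y
    rw [L2.inner_def]
    refine integral_congr_ae ?_
    filter_upwards [coeFn_gaborAtom h (y * Complex.I)] with t ht
    rw [ht]
    simp only [RCLike.inner_apply]
    simp
    ring
  rw [key]
  have hi : Integrable (fun t : ℝ => inner ℂ (f t) (h t)) := L2.integrable_inner f h
  refine continuous_of_dominated (bound := fun t : ℝ => ‖inner ℂ (f t) (h t)‖) ?_ ?_ hi.norm ?_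
  · intro y
    refine AEStronglyMeasurable.mul (Continuous.aestronglyMeasurable (by fun_prop)) hi.1
  · intro y
    refine Filter.Eventually.of_forall fun t => ?_
    rw [norm_mul, norm_exp_modulation, one_mul]
  · refine Filter.Eventually.of_forall fun t => ?_
    fun_prop

theorem continuous_gaborAtom_ofReal (g : L2R) :
    Continuous fun x : ℝ => gaborAtom g (x : ℂ) := by
  -- For real shifts there is no modulation; what remains is the translation action, continuous on
  -- `L^p` for `p < ∞`.
  have : (fun x : ℝ => gaborAtom g (x : ℂ)) = fun x : ℝ => DomAddAct.mk (-x) +ᵥ g := by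
    funext x
    refine Lp.ext ?_
    filter_upwards [coeFn_gaborAtom g x, DomAddAct.vadd_Lp_ae_eq (DomAddAct.mk (-x)) g]
      with t h1 h2
    rw [h1, h2]
    simp [sub_eq_neg_add]
  rw [this]
  have h : Continuous fun x : ℝ => DomAddAct.mk (-x) :=
    DomAddAct.continuous_mk.comp continuous_neg
  have : Fact ((2 : ℝ≥0∞) ≠ ∞) := ⟨by norm_num⟩
  exact h.vadd continuous_const

/-- Weak continuity together with constancy of the norm gives strong continuity, by expanding the
square of the difference. -/
theorem continuous_modulation (h : L2R) :
    Continuous fun y : ℝ => gaborAtom h (y * Complex.I) := by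
  refine continuous_iff_continuousAt.2 fun y₀ => ?_
  rw [ContinuousAt, tendsto_iff_norm_sub_tendsto_zero]
  have h1 : ∀ y : ℝ, ‖gaborAtom h (y * Complex.I) - gaborAtom h (y₀ * Complex.I)‖ =
      √(2 * ‖h‖ ^ 2 - 2 *
        (inner ℂ (gaborAtom h (y₀ * Complex.I)) (gaborAtom h (y * Complex.I))).re) := by
    intro y
    rw [← Real.sqrt_sq (norm_nonneg (gaborAtom h _ - _)), norm_sub_rev,
      @norm_sub_sq ℂ, norm_gaborAtom, norm_gaborAtom]
    congr 1
    simp only [RCLike.re_eq_complex_re]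
    ring
  simp_rw [h1]
  have hc : Continuous fun y : ℝ => √(2 * ‖h‖ ^ 2 - 2 *
        (inner ℂ (gaborAtom h (y₀ * Complex.I)) (gaborAtom h (y * Complex.I))).re) := by
    have := continuous_inner_modulation (gaborAtom h (y₀ * Complex.I)) h
    fun_prop
  have := hc.tendsto y₀
  rwa [← h1 y₀, sub_self, norm_zero] at this

/-- Translating first and modulating second produces no phase. Since modulations are isometries, the
translation error is independent of the modulation, and the two continuity statements add up. -/
theorem continuous_gaborAtom (g : L2R) : Continuous fun z : ℂ => gaborAtom g z := by
  have hdec : ∀ z : ℂ, gaborAtom g z = gaborAtom (gaborAtom g (z.re : ℂ)) (z.im * Complex.I) := by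
    intro z
    rw [gaborAtom_gaborAtom, add_comm, Complex.re_add_im]
    simp [shiftPhase]
  refine continuous_iff_continuousAt.2 fun z₀ => ?_
  rw [ContinuousAt, tendsto_iff_norm_sub_tendsto_zero]
  have hb : ∀ z : ℂ, ‖gaborAtom g z - gaborAtom g z₀‖ ≤
      ‖gaborAtom g (z.re : ℂ) - gaborAtom g (z₀.re : ℂ)‖ +
      ‖gaborAtom (gaborAtom g (z₀.re : ℂ)) (z.im * Complex.I) -
        gaborAtom (gaborAtom g (z₀.re : ℂ)) (z₀.im * Complex.I)‖ := by
    intro z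
    rw [hdec z, hdec z₀]
    refine (norm_sub_le_norm_sub_add_norm_sub _
      (gaborAtom (gaborAtom g (z₀.re : ℂ)) (z.im * Complex.I)) _).trans ?_
    rw [← gaborAtom_sub, norm_gaborAtom]
  refine squeeze_zero (fun _ => norm_nonneg _) hb ?_
  have h1 : Continuous fun z : ℂ => ‖gaborAtom g (z.re : ℂ) - gaborAtom g (z₀.re : ℂ)‖ +
      ‖gaborAtom (gaborAtom g (z₀.re : ℂ)) (z.im * Complex.I) -
        gaborAtom (gaborAtom g (z₀.re : ℂ)) (z₀.im * Complex.I)‖ := by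
    have a := (continuous_gaborAtom_ofReal g).comp Complex.continuous_re
    have b := (continuous_modulation (gaborAtom g (z₀.re : ℂ))).comp Complex.continuous_im
    simp only [Function.comp_def] at a b
    fun_prop
  have := h1.tendsto z₀
  simpa using this

theorem continuous_gaborTransform (g f : L2R) : Continuous (gaborTransform g f) :=
  (continuous_gaborAtom g).inner continuous_const

/-- Covariance of the Gabor transform. -/
theorem norm_gaborTransform_gaborAtom (g f : L2R) (z w : ℂ) :
    ‖gaborTransform g (gaborAtom f z) w‖ = ‖gaborTransform g f (w - z)‖ := by
  rw [gaborTransform, gaborTransform, ← inner_gaborAtom_gaborAtom (gaborAtom g (w - z)) f z,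
    gaborAtom_gaborAtom, inner_smul_left, norm_mul, RCLike.norm_conj, norm_shiftPhase, one_mul,
    add_sub_cancel]

/-! ### Plancherel's theorem and the orthogonality relations -/

open scoped FourierTransform SchwartzMap ContDiff in
/-- For functions in `L¹ ∩ L²` the `L²` Fourier transform is given by the Fourier integral. -/
theorem fourier_toLp_ae_eq {h : ℝ → ℂ} (h1 : Integrable h) (h2 : MemLp h 2) :
    (𝓕 (h2.toLp h) : Lp ℂ 2 (volume : Measure ℝ)) =ᵐ[volume] 𝓕 h := by
  have hcont : Continuous (𝓕 h) :=
    VectorFourier.fourierIntegral_continuous Real.continuous_fourierChar continuous_inner h1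
  -- Both sides are tested against smooth compactly supported functions. The transform moves onto
  -- the test function, by the distributional definition on one side and by Fubini (`e3`) on the
  -- other.
  refine ae_eq_of_integral_contDiff_smul_eq ((Lp.memLp _).locallyIntegrable (by norm_num))
    hcont.locallyIntegrable fun φ hφ hφc => ?_
  have hg₁ : HasCompactSupport (Complex.ofRealCLM ∘ φ) := hφc.comp_left rfl
  have hg₂ : ContDiff ℝ ∞ (Complex.ofRealCLM ∘ φ) := by fun_prop
  set ψ : 𝓢(ℝ, ℂ) := hg₁.toSchwartzMap hg₂
  have e := congrArg (fun T : 𝓢'(ℝ, ℂ) => T ψ)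
    (Lp.fourier_toTemperedDistribution_eq (h2.toLp h))
  simp only [TemperedDistribution.fourier_apply, Lp.toTemperedDistribution_apply] at e
  have e1 : ∫ x, φ x • (𝓕 (h2.toLp h) : Lp ℂ 2 (volume : Measure ℝ)) x
      = ∫ x, ψ x • (𝓕 (h2.toLp h) : Lp ℂ 2 (volume : Measure ℝ)) x := by
    simp [ψ]
  have e2 : ∫ x, φ x • 𝓕 h x = ∫ x, ψ x • 𝓕 h x := by
    simp [ψ]
  rw [e1, e2, ← e]
  have e3 := VectorFourier.integral_fourierIntegral_smul_eq_flip (μ := volume) (ν := volume)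
    (L := innerₗ ℝ) Real.continuous_fourierChar continuous_inner ψ.integrable h1
  have e4 : ∫ x, (𝓕 ψ) x • (h2.toLp h) x = ∫ x, (𝓕 ψ) x • h x :=
    integral_congr_ae (by filter_upwards [h2.coeFn_toLp] with x hx; rw [hx])
  rw [e4]
  rw [flip_innerₗ] at e3
  exact e3

theorem lintegral_enorm_sq_eq {α : Type*} {m : MeasurableSpace α} (μ : Measure α) (F : α → ℂ) :
    ∫⁻ x, ‖F x‖ₑ ^ 2 ∂μ = eLpNorm F 2 μ ^ 2 := by
  rw [eLpNorm_eq_lintegral_rpow_enorm_toReal (by norm_num) (by norm_num),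
    ← ENNReal.rpow_natCast, ← ENNReal.rpow_mul]
  simp

theorem lintegral_enorm_sq_Lp {α : Type*} {m : MeasurableSpace α} {μ : Measure α}
    (F : Lp ℂ 2 μ) : ∫⁻ x, ‖F x‖ₑ ^ 2 ∂μ = ‖F‖ₑ ^ 2 := by
  rw [Lp.enorm_def, lintegral_enorm_sq_eq]

open scoped FourierTransform in
/-- Plancherel's theorem on `L¹ ∩ L²`. -/
theorem lintegral_fourier_enorm_sq {h : ℝ → ℂ} (h1 : Integrable h) (h2 : MemLp h 2) :
    ∫⁻ ξ, ‖𝓕 h ξ‖ₑ ^ 2 = ∫⁻ t, ‖h t‖ₑ ^ 2 := by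
  calc ∫⁻ ξ, ‖𝓕 h ξ‖ₑ ^ 2
      = ∫⁻ ξ, ‖(𝓕 (h2.toLp h) : Lp ℂ 2 (volume : Measure ℝ)) ξ‖ₑ ^ 2 :=
        lintegral_congr_ae (by filter_upwards [fourier_toLp_ae_eq h1 h2] with x hx; rw [hx])
    _ = ∫⁻ t, ‖(h2.toLp h) t‖ₑ ^ 2 := by
        rw [lintegral_enorm_sq_Lp, lintegral_enorm_sq_Lp, ← ofReal_norm, ← ofReal_norm,
          Lp.norm_fourier_eq]
    _ = ∫⁻ t, ‖h t‖ₑ ^ 2 :=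
        lintegral_congr_ae (by filter_upwards [h2.coeFn_toLp] with x hx; rw [hx])

open scoped FourierTransform ComplexConjugate in
-- This form lets Plancherel be applied in `y` for fixed `x`; the sign comes from conjugating the
-- modulation.
theorem gaborTransform_eq_fourier (g f : L2R) (x y : ℝ) :
    gaborTransform g f ⟨x, y⟩ = 𝓕 (fun t : ℝ => f t * conj (g (t - x))) (-y) := by
  rw [Real.fourier_real_eq_integral_exp_smul, gaborTransform, L2.inner_def]
  refine integral_congr_ae ?_
  filter_upwards [coeFn_gaborAtom g ⟨x, y⟩] with t ht
  rw [ht]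
  have : conj (-2 * Real.pi * Complex.I * y * t : ℂ)
      = ((-2 * Real.pi * t * -y : ℝ) : ℂ) * Complex.I := by
    have h2 : conj (2 : ℂ) = 2 := Complex.conj_ofReal 2
    simp [h2]
    ring
  rw [RCLike.inner_apply, map_mul, ← Complex.exp_conj, smul_eq_mul, this]
  ring

open scoped ComplexConjugate in
/-- The orthogonality relations: the Gabor transform multiplies norms. -/
theorem lintegral_gaborTransform_sq (g f : L2R) :
    ∫⁻ z, ‖gaborTransform g f z‖ₑ ^ 2 = ‖g‖ₑ ^ 2 * ‖f‖ₑ ^ 2 := by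
  have hgm : StronglyMeasurable g := Lp.stronglyMeasurable g
  have hfm : StronglyMeasurable f := Lp.stronglyMeasurable f
  set h : ℝ → ℝ → ℂ := fun x t => f t * conj (g (t - x)) with hh
  have hm2 : Measurable (fun p : ℝ × ℝ => ‖h p.1 p.2‖ₑ ^ 2) := by
    have a : Measurable fun p : ℝ × ℝ => g (p.2 - p.1) :=
      hgm.measurable.comp (measurable_snd.sub measurable_fst)
    have b : Measurable fun p : ℝ × ℝ => f p.2 := hfm.measurable.comp measurable_snd
    have c : Measurable fun p : ℝ × ℝ => conj (g (p.2 - p.1)) :=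
      Complex.continuous_conj.measurable.comp a
    exact (b.mul c).enorm.pow_const 2
  have hdouble : ∫⁻ x, ∫⁻ t, ‖h x t‖ₑ ^ 2 = ‖g‖ₑ ^ 2 * ‖f‖ₑ ^ 2 := by
    rw [lintegral_lintegral_swap hm2.aemeasurable]
    have : ∀ t, ∫⁻ x, ‖h x t‖ₑ ^ 2 = ‖g‖ₑ ^ 2 * ‖f t‖ₑ ^ 2 := by
      intro t
      have e : ∀ x, ‖h x t‖ₑ ^ 2 = ‖f t‖ₑ ^ 2 * ‖g (t - x)‖ₑ ^ 2 := by
        intro x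
        rw [hh]
        simp only [enorm_mul, RCLike.enorm_conj, mul_pow]
      simp_rw [e]
      rw [lintegral_const_mul' _ _ (by finiteness),
        lintegral_sub_left_eq_self (fun s => ‖g s‖ₑ ^ 2) t, lintegral_enorm_sq_Lp, mul_comm]
    simp_rw [this]
    rw [lintegral_const_mul' _ _ (by finiteness), lintegral_enorm_sq_Lp]
  -- Plancherel needs `h x` in `L¹ ∩ L²`: integrability holds for every `x` by Hölder, square
  -- integrability only for almost every `x`, by Tonelli.
  have hfin : ∀ᵐ x, ∫⁻ t, ‖h x t‖ₑ ^ 2 < ∞ := by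
    refine ae_lt_top hm2.lintegral_prod_right' ?_
    rw [hdouble]
    finiteness
  have hint : ∀ x, Integrable (h x) := by
    intro x
    have h1 : MemLp (fun t : ℝ => g (t - x)) 2 volume :=
      (Lp.memLp g).comp_measurePreserving (measurePreserving_sub_right volume x)
    exact (Lp.memLp f).integrable_mul h1.star
  rw [← Complex.volume_preserving_equiv_real_prod.symm.lintegral_comp_emb
    (MeasurableEquiv.measurableEmbedding _)]
  have hcm : Measurable fun p : ℝ × ℝ =>
      ‖gaborTransform g f (Complex.measurableEquivRealProd.symm p)‖ₑ ^ 2 :=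
    ((continuous_gaborTransform g f).measurable.comp
      (MeasurableEquiv.measurable _)).enorm.pow_const 2
  rw [Measure.volume_eq_prod, lintegral_prod _ hcm.aemeasurable, ← hdouble]
  refine lintegral_congr_ae ?_
  filter_upwards [hfin] with x hx
  have hL2 : MemLp (h x) 2 := by
    refine ⟨(hint x).1, ?_⟩
    rw [lintegral_enorm_sq_eq] at hx
    by_contra hcon
    rw [not_lt, top_le_iff] at hcon
    simp [hcon] at hx
  rw [← lintegral_fourier_enorm_sq (hint x) hL2, ← lintegral_neg_eq_self]
  refine lintegral_congr fun y => ?_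
  have := gaborTransform_eq_fourier g f x (-y)
  rw [neg_neg] at this
  rw [hh, ← this]
  rfl

theorem memLp_gaborTransform (g f : L2R) : MemLp (gaborTransform g f) 2 volume := by
  refine ⟨(continuous_gaborTransform g f).aestronglyMeasurable, ?_⟩
  have h := lintegral_gaborTransform_sq g f
  rw [lintegral_enorm_sq_eq] at h
  by_contra hcon
  rw [not_lt, top_le_iff] at hcon
  rw [hcon] at h
  have : ‖g‖ₑ ^ 2 * ‖f‖ₑ ^ 2 ≠ ∞ := by finiteness
  exact this (by rw [← h]; simp)

theorem gaborTransform_add (g f₁ f₂ : L2R) (z : ℂ) :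
    gaborTransform g (f₁ + f₂) z = gaborTransform g f₁ z + gaborTransform g f₂ z :=
  inner_add_right _ _ _

theorem gaborTransform_smul (g : L2R) (c : ℂ) (f : L2R) (z : ℂ) :
    gaborTransform g (c • f) z = c * gaborTransform g f z :=
  inner_smul_right _ _ _

/-- The Gabor transform with a normalised window, as an isometry into `L²(ℂ)`. -/
noncomputable def gaborIsometry (g : L2R) (hg : ‖g‖ = 1) :
    L2R →ₗᵢ[ℂ] Lp ℂ 2 (volume : Measure ℂ) where
  toFun f := (memLp_gaborTransform g f).toLp _
  map_add' f₁ f₂ := by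
    rw [← MemLp.toLp_add]
    exact MemLp.toLp_congr _ _ (Filter.Eventually.of_forall (gaborTransform_add g f₁ f₂))
  map_smul' c f := by
    rw [RingHom.id_apply, ← MemLp.toLp_const_smul]
    exact MemLp.toLp_congr _ _ (Filter.Eventually.of_forall (gaborTransform_smul g c f))
  norm_map' f := by
    have h := lintegral_gaborTransform_sq g f
    have hg' : ‖g‖ₑ = 1 := by rw [← ofReal_norm, hg, ENNReal.ofReal_one]
    rw [lintegral_enorm_sq_eq, hg', one_pow, one_mul] at h
    have h2 : eLpNorm (gaborTransform g f) 2 volume = ‖f‖ₑ :=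
      (ENNReal.pow_right_strictMono two_ne_zero).injective h
    change ‖(memLp_gaborTransform g f).toLp _‖ = ‖f‖
    rw [Lp.norm_toLp, h2, toReal_enorm]

open scoped ComplexConjugate in
/-- The reproducing formula. -/
theorem inner_eq_integral_gaborTransform {g : L2R} (hg : ‖g‖ = 1) (f₁ f₂ : L2R) :
    inner ℂ f₁ f₂ = ∫ z, conj (gaborTransform g f₁ z) * gaborTransform g f₂ z := by
  rw [← (gaborIsometry g hg).inner_map_map f₁ f₂, L2.inner_def]
  refine integral_congr_ae ?_
  filter_upwards [(memLp_gaborTransform g f₁).coeFn_toLp,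
    (memLp_gaborTransform g f₂).coeFn_toLp] with z h1 h2
  change inner ℂ ((memLp_gaborTransform g f₁).toLp _ z) ((memLp_gaborTransform g f₂).toLp _ z) = _
  rw [h1, h2, RCLike.inner_apply, mul_comm]

theorem normSqL2_gaborTransform {g : L2R} (hg : ‖g‖ = 1) (f : L2R) :
    normSqL2 (gaborTransform g f) = ‖f‖ ^ 2 := by
  have hg' : ‖g‖ₑ = 1 := by rw [← ofReal_norm, hg, ENNReal.ofReal_one]
  have h := lintegral_gaborTransform_sq g f
  rw [hg', one_pow, one_mul] at h
  have hc : Continuous fun z => ‖gaborTransform g f z‖ ^ 2 :=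
    (continuous_gaborTransform g f).norm.pow 2
  rw [normSqL2, integral_eq_lintegral_of_nonneg_ae
    (Filter.Eventually.of_forall fun _ => by positivity) hc.aestronglyMeasurable]
  have e : ∀ z, ENNReal.ofReal (‖gaborTransform g f z‖ ^ 2) = ‖gaborTransform g f z‖ₑ ^ 2 := by
    intro z
    rw [ENNReal.ofReal_pow (norm_nonneg _), ofReal_norm]
  simp_rw [e, h]
  rw [ENNReal.toReal_pow, toReal_enorm]

/-! ### The local maximal function of the kernel -/

theorem enorm_gaborTransform_gaborAtom (g f : L2R) (z w : ℂ) :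
    ‖gaborTransform g (gaborAtom f z) w‖ₑ = ‖gaborTransform g f (w - z)‖ₑ := by
  rw [← ofReal_norm, ← ofReal_norm, norm_gaborTransform_gaborAtom]

/-- The reproducing formula is used with a window `φ` unrelated to `g`; covariance turns its first
factor into a translate. -/
theorem enorm_gaborTransform_le_convolution {φ : L2R} (hφ : ‖φ‖ = 1) (g f : L2R) (z : ℂ) :
    ‖gaborTransform g f z‖ₑ ≤
      ∫⁻ w, ‖gaborTransform φ g (w - z)‖ₑ * ‖gaborTransform φ f w‖ₑ := by
  rw [gaborTransform, inner_eq_integral_gaborTransform hφ]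
  refine (enorm_integral_le_lintegral_enorm _).trans_eq (lintegral_congr fun w => ?_)
  rw [enorm_mul, RCLike.enorm_conj, enorm_gaborTransform_gaborAtom]

theorem lintegral_setLIntegral_add {u : ℂ → ℝ≥0∞} (hu : Measurable u) (s : Set ℂ) :
    ∫⁻ z, ∫⁻ w in s, u (z + w) = volume s * ∫⁻ z, u z := by
  rw [lintegral_lintegral_swap (f := fun z w => u (z + w))
    (hu.comp measurable_add).aemeasurable]
  simp_rw [lintegral_add_right_eq_self]
  rw [lintegral_const, Measure.restrict_apply_univ, mul_comm]

/-- The average of the time-frequency shifts of `g` over a small disc. -/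
theorem exists_setIntegral_gaborAtom_ne_zero {g : L2R} (hg : ‖g‖ = 1) :
    ∃ r : ℝ, 0 < r ∧ ∫ w in ball (0 : ℂ) r, gaborAtom g w ≠ 0 := by
  -- On this disc the shifts stay within `1/2` of `g`, whereas a vanishing integral would force a
  -- mean deviation of `‖g‖ = 1`.
  obtain ⟨r, hr, hball⟩ := Metric.continuousAt_iff.1
    ((continuous_gaborAtom g).continuousAt (x := 0)) (1 / 2) (by norm_num)
  refine ⟨r, hr, fun h0 => ?_⟩
  have hvol : volume (ball (0 : ℂ) r) < ∞ := measure_ball_lt_top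
  have hi : IntegrableOn (fun w => gaborAtom g w) (ball (0 : ℂ) r) :=
    ((continuous_gaborAtom g).continuousOn.integrableOn_compact
      (isCompact_closedBall (0 : ℂ) r)).mono_set ball_subset_closedBall
  have h1 : ∫ w in ball (0 : ℂ) r, (gaborAtom g w - g)
      = -(volume.real (ball (0 : ℂ) r) • g) := by
    rw [integral_sub hi (integrableOn_const hvol.ne enorm_ne_top), h0, setIntegral_const, zero_sub]
  have h2 := norm_setIntegral_le_of_norm_le_const (f := fun w => gaborAtom g w - g)
    (C := 1 / 2) hvol (fun w hw => by
      have := hball (x := w) hw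
      rw [gaborAtom_zero, dist_eq_norm] at this
      exact this.le)
  rw [h1, norm_neg, norm_smul, hg, mul_one, Real.norm_of_nonneg measureReal_nonneg] at h2
  have h3 : 0 < volume.real (ball (0 : ℂ) r) :=
    ENNReal.toReal_pos (measure_ball_pos volume _ hr).ne' hvol.ne
  linarith

/-- The shift by `z` passes under the Bochner integral, and composing it with the shift by `w` gives
the shift by `z + w` up to a phase. -/
theorem enorm_gaborTransform_setIntegral_le (g f : L2R) (r : ℝ) (z : ℂ) :
    ‖gaborTransform (∫ w in ball (0 : ℂ) r, gaborAtom g w) f z‖ₑ ≤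
      ∫⁻ w in ball (0 : ℂ) r, ‖gaborTransform g f (z + w)‖ₑ := by
  have hi : IntegrableOn (fun w => gaborAtom g w) (ball (0 : ℂ) r) :=
    ((continuous_gaborAtom g).continuousOn.integrableOn_compact
      (isCompact_closedBall (0 : ℂ) r)).mono_set ball_subset_closedBall
  have h1 : gaborAtom (∫ w in ball (0 : ℂ) r, gaborAtom g w) z
      = ∫ w in ball (0 : ℂ) r, gaborAtom (gaborAtom g w) z :=
    ((gaborShift z).toContinuousLinearMap.integral_comp_comm hi).symm
  have hi' : IntegrableOn (fun w => gaborAtom (gaborAtom g w) z) (ball (0 : ℂ) r) :=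
    (gaborShift z).toContinuousLinearMap.integrable_comp hi
  rw [gaborTransform, ← ofReal_norm, ← norm_inner_symm, ofReal_norm, h1, ← integral_inner hi']
  refine (enorm_integral_le_lintegral_enorm _).trans_eq (lintegral_congr fun w => ?_)
  rw [← ofReal_norm, norm_inner_symm, gaborAtom_gaborAtom, inner_smul_left, norm_mul,
    RCLike.norm_conj, norm_shiftPhase, one_mul, ofReal_norm, gaborTransform]

/-- The window is the normalised average of shifts over a disc of radius `r`. Moving the centre by
less than `1` only requires enlarging the disc to `R = r + 1`, so the bound is uniform in `z'`. -/
theorem exists_window_bound {g : L2R} (hg : ‖g‖ = 1) :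
    ∃ φ : L2R, ‖φ‖ = 1 ∧ ∃ (C : ℝ≥0∞) (R : ℝ), C ≠ ∞ ∧ ∀ z, ∀ z' ∈ ball z 1,
      ‖gaborTransform φ g z'‖ₑ ≤ C * ∫⁻ w in ball (0 : ℂ) R, ‖gaborTransform g g (z + w)‖ₑ := by
  obtain ⟨r, hr, hne⟩ := exists_setIntegral_gaborAtom_ne_zero hg
  set φ₀ := ∫ w in ball (0 : ℂ) r, gaborAtom g w with hφ₀
  refine ⟨((‖φ₀‖⁻¹ : ℝ) : ℂ) • φ₀, ?_, ‖φ₀‖ₑ⁻¹, r + 1, ?_, ?_⟩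
  · rw [norm_smul, Complex.norm_real, norm_inv, norm_norm, inv_mul_cancel₀ (norm_ne_zero_iff.2 hne)]
  · exact ENNReal.inv_ne_top.2 (enorm_ne_zero.2 hne)
  · intro z z' hz'
    have h1 : ‖gaborTransform (((‖φ₀‖⁻¹ : ℝ) : ℂ) • φ₀) g z'‖ₑ
        = ‖φ₀‖ₑ⁻¹ * ‖gaborTransform φ₀ g z'‖ₑ := by
      rw [gaborTransform, gaborAtom_smul, inner_smul_left, enorm_mul, RCLike.enorm_conj,
        ← gaborTransform, ← ofReal_norm (Complex.ofReal _), Complex.norm_real, norm_inv, norm_norm,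
        ENNReal.ofReal_inv_of_pos (norm_pos_iff.2 hne), ofReal_norm]
    rw [h1]
    refine mul_le_mul_right ((enorm_gaborTransform_setIntegral_le g g r z').trans ?_) _
    rw [← lintegral_indicator measurableSet_ball, ← lintegral_indicator measurableSet_ball,
      ← lintegral_add_left_eq_self (fun w => (ball (0 : ℂ) r).indicator
        (fun w => ‖gaborTransform g g (z' + w)‖ₑ) w) (z - z')]
    refine lintegral_mono fun w => ?_
    by_cases hw : z - z' + w ∈ ball (0 : ℂ) r
    · have hw' : w ∈ ball (0 : ℂ) (r + 1) := by
        rw [mem_ball_zero_iff] at hw ⊢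
        rw [mem_ball, dist_eq_norm] at hz'
        calc ‖w‖ = ‖(z - z' + w) + (z' - z)‖ := by congr 1; ring
          _ ≤ ‖z - z' + w‖ + ‖z' - z‖ := norm_add_le _ _
          _ < r + 1 := by linarith
      rw [Set.indicator_of_mem hw, Set.indicator_of_mem hw']
      refine le_of_eq ?_
      congr 2
      ring
    · rw [Set.indicator_of_notMem hw]
      exact zero_le

theorem lintegral_kernel_lt_top {g : L2R} (hA : g ∈ feichtingerAlgebra) :
    ∫⁻ w, ‖gaborTransform g g w‖ₑ < ∞ := by
  have : Integrable (fun z : ℂ => gaborTransform g g z) volume := hA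
  exact this.2

/-- In the convolution bound for `k(z')` only one factor depends on `z'`. Replacing both by the
integrable local majorant `b` bounds the supremum over `z'` by a convolution, whose integral is `(∫
b)²`. -/
theorem lintegral_localMaximal_lt_top {g : L2R} (hg : ‖g‖ = 1) (hA : g ∈ feichtingerAlgebra) :
    ∫⁻ w, localMaximal (gaborTransform g g) w < ∞ := by
  obtain ⟨φ, hφ, C, R, hC, hb⟩ := exists_window_bound hg
  have hkm : Measurable fun z => ‖gaborTransform g g z‖ₑ :=
    (continuous_gaborTransform g g).measurable.enorm
  set b : ℂ → ℝ≥0∞ := fun z => C * ∫⁻ w in ball (0 : ℂ) R, ‖gaborTransform g g (z + w)‖ₑ with hbdef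
  have hbm : Measurable b :=
    (Measurable.lintegral_prod_right' (f := fun p : ℂ × ℂ => ‖gaborTransform g g (p.1 + p.2)‖ₑ)
      (hkm.comp measurable_add)).const_mul C
  have hbi : ∫⁻ z, b z < ∞ := by
    rw [hbdef, lintegral_const_mul' _ _ hC, lintegral_setLIntegral_add hkm]
    exact ENNReal.mul_lt_top hC.lt_top
      (ENNReal.mul_lt_top measure_ball_lt_top (lintegral_kernel_lt_top hA))
  have hM : ∀ z, localMaximal (gaborTransform g g) z ≤ ∫⁻ w, b (w - z) * b w := by
    intro z
    refine iSup₂_le fun z' hz' => (enorm_gaborTransform_le_convolution hφ g g z').trans ?_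
    refine lintegral_mono fun w => mul_le_mul' (hb _ _ ?_) (hb w w (mem_ball_self one_pos))
    rw [mem_ball, dist_eq_norm] at hz' ⊢
    rwa [sub_sub_sub_cancel_left, norm_sub_rev]
  refine (lintegral_mono hM).trans_lt ?_
  rw [lintegral_lintegral_swap]
  · have hin : ∀ w, ∫⁻ z, b (w - z) * b w = (∫⁻ z, b z) * b w := fun w => by
      rw [lintegral_mul_const (f := fun z => b (w - z)) _
        (hbm.comp (measurable_const.sub measurable_id)), lintegral_sub_left_eq_self]
    simp_rw [hin]
    rw [lintegral_const_mul _ hbm]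
    exact ENNReal.mul_lt_top hbi hbi
  · exact ((hbm.comp (measurable_snd.sub measurable_fst)).mul (hbm.comp measurable_snd)).aemeasurable

theorem enorm_le_localMaximal {F : ℂ → ℂ} {z w : ℂ} (h : w ∈ ball z 1) :
    ‖F w‖ₑ ≤ localMaximal F z :=
  le_iSup₂ (f := fun w (_ : w ∈ ball z 1) => ‖F w‖ₑ) w h

/-- Dominated convergence: `|k_z(w)| = |k(w - z)| ≤ Mk(w)` when `|z| < 1`, so `2Mk` is an integrable
majorant. -/
theorem tendsto_lintegral_kernel_sub {g : L2R} (hg : ‖g‖ = 1) (hA : g ∈ feichtingerAlgebra) :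
    Filter.Tendsto (fun z => ∫⁻ w, ‖gaborKernel g z w - gaborTransform g g w‖ₑ) (nhds 0)
      (nhds 0) := by
  have hz : (0 : ℝ≥0∞) = ∫⁻ _ : ℂ, 0 := by simp
  rw [hz]
  refine tendsto_lintegral_filter_of_dominated_convergence
    (fun w => 2 * localMaximal (gaborTransform g g) w) ?_ ?_ ?_ ?_
  · exact Filter.Eventually.of_forall fun z => ((continuous_gaborTransform g _).sub
      (continuous_gaborTransform g g)).measurable.enorm
  · filter_upwards [ball_mem_nhds (0 : ℂ) one_pos] with z hz
    refine Filter.Eventually.of_forall fun w => ?_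
    refine (enorm_sub_le).trans ?_
    rw [gaborKernel, enorm_gaborTransform_gaborAtom, two_mul]
    refine add_le_add (enorm_le_localMaximal ?_) (enorm_le_localMaximal (mem_ball_self one_pos))
    rw [mem_ball_zero_iff] at hz
    rwa [mem_ball, dist_eq_norm, sub_sub_cancel_left, norm_neg]
  · rw [lintegral_const_mul' _ _ (by norm_num)]
    exact (ENNReal.mul_lt_top (by norm_num) (lintegral_localMaximal_lt_top hg hA)).ne
  · refine Filter.Eventually.of_forall fun w => ?_
    have hc : Continuous fun z => ‖gaborKernel g z w - gaborTransform g g w‖ₑ := by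
      have : Continuous fun z => gaborKernel g z w :=
        continuous_const.inner (continuous_gaborAtom g)
      exact (this.sub continuous_const).enorm
    have := hc.tendsto 0
    rwa [gaborKernel, gaborAtom_zero, sub_self, enorm_zero] at this

theorem exists_kernelOscillation_le {g : L2R} (hg : ‖g‖ = 1) (hA : g ∈ feichtingerAlgebra)
    {ε : ℝ≥0∞} (hε : 0 < ε) : ∃ δ : ℝ, 0 < δ ∧ δ ≤ 1 ∧ kernelOscillation g δ ≤ ε := by
  obtain ⟨r, hr, h⟩ := Metric.eventually_nhds_iff_ball.1
    ((tendsto_lintegral_kernel_sub hg hA).eventually (ge_mem_nhds hε))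
  refine ⟨min (r / 2) 1, by positivity, min_le_right _ _, iSup₂_le fun z hz => h z ?_⟩
  rw [mem_closedBall_zero_iff] at hz
  rw [mem_ball_zero_iff]
  linarith [min_le_left (r / 2) 1]

theorem exists_deviationSq_lt_one {g : L2R} (hg : ‖g‖ = 1) (hA : g ∈ feichtingerAlgebra) :
    ∃ δ : ℝ, 0 < δ ∧ δ ≤ 1 ∧ deviationSq g δ < 1 := by
  set N := (∫⁻ w, ‖gaborTransform g g w‖ₑ) + ∫⁻ w, localMaximal (gaborTransform g g) w with hN
  have hNfin : N ≠ ∞ :=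
    (ENNReal.add_lt_top.2 ⟨lintegral_kernel_lt_top hA, lintegral_localMaximal_lt_top hg hA⟩).ne
  obtain ⟨δ, h0, h1, h2⟩ := exists_kernelOscillation_le hg hA
    -- This makes the product with `N` at most `1/2`; `N + 1` avoids inverting zero.
    (ε := (N + 1)⁻¹ * 2⁻¹) (by
      refine ENNReal.mul_pos (ENNReal.inv_ne_zero.2 (by finiteness)) (by norm_num))
  refine ⟨δ, h0, h1, ?_⟩
  calc deviationSq g δ = kernelOscillation g δ * N := rfl
    _ ≤ ((N + 1)⁻¹ * 2⁻¹) * (N + 1) := mul_le_mul' h2 le_self_add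
    _ = 2⁻¹ := by
        rw [mul_right_comm, ENNReal.inv_mul_cancel (by simp) (by finiteness), one_mul]
    _ < 1 := by norm_num

/-! ### Voronoi cells of a separated, relatively dense set -/

/-- The open Voronoi cell of `γ` with respect to `Γ`. -/
def voronoiCell (Γ : Set ℂ) (γ : ℂ) : Set ℂ :=
  {z | ∀ γ' ∈ Γ, γ' ≠ γ → dist z γ < dist z γ'}

theorem finite_inter_closedBall_of_separated {Γ : Set ℂ} {α : ℝ} (hα : 0 < α)
    (hsep : ∀ z ∈ Γ, ∀ w ∈ Γ, z ≠ w → α ≤ ‖z - w‖) (z : ℂ) (R : ℝ) :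
    (Γ ∩ closedBall z R).Finite := by
  by_contra hinf
  rw [← Set.Infinite] at hinf
  obtain ⟨x, -, hx⟩ := hinf.exists_accPt_of_subset_isCompact (isCompact_closedBall z R)
    Set.inter_subset_right
  have h1 := accPt_iff_frequently.1 hx
  have hmem : ∀ U ∈ nhds x, ∃ y ∈ U, y ≠ x ∧ y ∈ Γ ∩ closedBall z R := by
    intro U hU
    obtain ⟨y, ⟨hy1, hy2⟩, hyU⟩ := (h1.and_eventually hU).exists
    exact ⟨y, hyU, hy1, hy2⟩
  -- Two points of `Γ` within `α / 2` of the accumulation point contradict separation; the second is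
  -- chosen strictly closer than the first, hence distinct from it.
  obtain ⟨y, hyb, hyx, hyΓ⟩ := hmem _ (ball_mem_nhds x (half_pos hα))
  obtain ⟨y', hyb', hyx', hyΓ'⟩ := hmem _ (ball_mem_nhds x (dist_pos.2 hyx))
  rw [mem_ball] at hyb hyb'
  have hne : y ≠ y' := by
    rintro rfl
    exact lt_irrefl _ hyb'
  have := hsep y hyΓ.1 y' hyΓ'.1 hne
  rw [← dist_eq_norm] at this
  linarith [dist_triangle_right y y' x]

theorem countable_of_separated {Γ : Set ℂ} {α : ℝ} (hα : 0 < α)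
    (hsep : ∀ z ∈ Γ, ∀ w ∈ Γ, z ≠ w → α ≤ ‖z - w‖) : Γ.Countable := by
  have : Γ = ⋃ n : ℕ, Γ ∩ closedBall 0 n := by
    rw [← Set.inter_iUnion, iUnion_closedBall_nat, Set.inter_univ]
  rw [this]
  exact Set.countable_iUnion fun n => (finite_inter_closedBall_of_separated hα hsep 0 n).countable

theorem ball_subset_voronoiCell {Γ : Set ℂ} {α : ℝ}
    (hsep : ∀ z ∈ Γ, ∀ w ∈ Γ, z ≠ w → α ≤ ‖z - w‖) {γ : ℂ} (hγ : γ ∈ Γ) :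
    ball γ (α / 2) ⊆ voronoiCell Γ γ := by
  intro z hz γ' hγ' hne
  rw [mem_ball] at hz
  have := hsep γ hγ γ' hγ' hne.symm
  rw [← dist_eq_norm] at this
  linarith [dist_triangle_left γ γ' z]

theorem voronoiCell_subset_ball {Γ : Set ℂ} {δ : ℝ}
    (hd : ∀ z : ℂ, (ball z δ ∩ Γ).Nonempty) (γ : ℂ) :
    voronoiCell Γ γ ⊆ ball γ δ := by
  intro z hz
  obtain ⟨γ', hb, hγ'⟩ := hd z
  rw [mem_ball, dist_comm] at hb
  rw [mem_ball]
  by_cases h : γ' = γ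
  · rwa [← h]
  · exact (hz γ' hγ' h).trans hb

theorem isOpen_voronoiCell {Γ : Set ℂ} {α δ : ℝ} (hα : 0 < α)
    (hsep : ∀ z ∈ Γ, ∀ w ∈ Γ, z ≠ w → α ≤ ‖z - w‖)
    (hd : ∀ z : ℂ, (ball z δ ∩ Γ).Nonempty) (γ : ℂ) : IsOpen (voronoiCell Γ γ) := by
  -- Points of `Γ` farther than `2δ` from `γ` impose no condition inside `ball γ δ`, so finitely
  -- many open conditions define the cell.
  have hfin := finite_inter_closedBall_of_separated hα hsep γ (2 * δ)
  have : voronoiCell Γ γ = ball γ δ ∩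
      ⋂ γ' ∈ Γ ∩ closedBall γ (2 * δ), {z | γ' ≠ γ → dist z γ < dist z γ'} := by
    ext z
    constructor
    · intro hz
      refine ⟨voronoiCell_subset_ball hd γ hz, Set.mem_iInter₂.2 fun γ' h => hz γ' h.1⟩
    · rintro ⟨hz, h⟩ γ' hγ' hne
      by_cases hc : γ' ∈ closedBall γ (2 * δ)
      · exact Set.mem_iInter₂.1 h γ' ⟨hγ', hc⟩ hne
      · rw [mem_closedBall, not_le] at hc
        rw [mem_ball] at hz
        linarith [dist_triangle_left γ' γ z]
  rw [this]
  refine isOpen_ball.inter (hfin.isOpen_biInter fun γ' _ => ?_)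
  by_cases hne : γ' = γ
  · simp [hne]
  · simpa [hne] using isOpen_lt (continuous_id.dist continuous_const)
      (continuous_id.dist continuous_const)

theorem exists_nearest_point {Γ : Set ℂ} {α δ : ℝ} (hα : 0 < α)
    (hsep : ∀ z ∈ Γ, ∀ w ∈ Γ, z ≠ w → α ≤ ‖z - w‖)
    (hd : ∀ z : ℂ, (ball z δ ∩ Γ).Nonempty) (z : ℂ) :
    ∃ γ ∈ Γ, ∀ γ' ∈ Γ, dist z γ ≤ dist z γ' := by
  obtain ⟨γ₀, hb, hγ₀⟩ := hd z
  obtain ⟨γ, hγ, hmin⟩ := Set.exists_min_image _ (dist z)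
    (finite_inter_closedBall_of_separated hα hsep z δ) ⟨γ₀, hγ₀, ball_subset_closedBall hb⟩
  refine ⟨γ, hγ.1, fun γ' hγ' => ?_⟩
  by_cases hc : γ' ∈ closedBall z δ
  · exact hmin γ' ⟨hγ', hc⟩
  · have h1 := hγ.2
    rw [mem_closedBall, dist_comm] at h1 hc
    linarith

/-- Along the segment from `γ` to `z`, the difference of squared distances to `γ'` and `γ` is
affine, positive at `γ` and nonnegative at `z`. So the segment without `z` lies in the cell. -/
theorem mem_closure_voronoiCell {Γ : Set ℂ} {γ z : ℂ}
    (hmin : ∀ γ' ∈ Γ, dist z γ ≤ dist z γ') : z ∈ closure (voronoiCell Γ γ) := by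
  have hseg : ∀ t ∈ Set.Ico (0 : ℝ) 1, γ + t * (z - γ) ∈ voronoiCell Γ γ := by
    intro t ht γ' hγ' hne
    have h1 := hmin γ' hγ'
    have h2 : 0 < dist γ γ' := dist_pos.2 hne.symm
    rw [Complex.dist_eq_re_im] at h2
    rw [Complex.dist_eq_re_im, Complex.dist_eq_re_im, Real.sqrt_le_sqrt_iff (by positivity)] at h1
    rw [Complex.dist_eq_re_im, Complex.dist_eq_re_im]
    refine Real.sqrt_lt_sqrt (by positivity) ?_
    rw [Real.sqrt_pos] at h2
    simp only [Complex.add_re, Complex.add_im, Complex.re_ofReal_mul, Complex.im_ofReal_mul,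
      Complex.sub_re, Complex.sub_im]
    nlinarith [mul_nonneg ht.1 (sub_nonneg.2 h1), mul_pos (sub_pos.2 ht.2) h2]
  have hlim : Filter.Tendsto (fun t : ℝ => γ + t * (z - γ)) (nhdsWithin 1 (Set.Iio 1))
      (nhds z) := by
    have hc : Continuous fun t : ℝ => γ + t * (z - γ) := by fun_prop
    have := (hc.tendsto 1).mono_left (nhdsWithin_le_nhds (s := Set.Iio 1))
    simpa using this
  refine mem_closure_of_tendsto hlim ?_
  filter_upwards [Ico_mem_nhdsLT (zero_lt_one' ℝ)] with t ht using hseg t ht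

theorem volume_setOf_dist_eq {γ γ' : ℂ} (h : γ ≠ γ') :
    volume {z : ℂ | dist z γ = dist z γ'} = 0 := by
  have : {z : ℂ | dist z γ = dist z γ'} = AffineSubspace.perpBisector γ γ' := by
    ext z
    exact AffineSubspace.mem_perpBisector_iff_dist_eq.symm
  rw [this]
  exact Measure.addHaar_affineSubspace _ _ fun h' => h (AffineSubspace.perpBisector_eq_top.1 h')

theorem isCellPartition_voronoiCell {Γ : Set ℂ} {α δ : ℝ} (hα : 0 < α)
    (hsep : ∀ z ∈ Γ, ∀ w ∈ Γ, z ≠ w → α ≤ ‖z - w‖)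
    (hd : ∀ z : ℂ, (ball z δ ∩ Γ).Nonempty) :
    IsCellPartition Γ α δ fun γ => voronoiCell Γ γ where
  isOpen γ := isOpen_voronoiCell hα hsep hd γ
  disjoint γ γ' hne := Set.disjoint_left.2 fun z hz hz' =>
    lt_asymm (hz γ' γ'.2 fun h => hne (Subtype.ext h).symm) (hz' γ γ.2 fun h => hne (Subtype.ext h))
  closure_cover := Set.eq_univ_of_forall fun z => by
    obtain ⟨γ, hγ, hmin⟩ := exists_nearest_point hα hsep hd z
    exact Set.mem_iUnion.2 ⟨⟨γ, hγ⟩, mem_closure_voronoiCell hmin⟩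
  null_compl := by
    have hc := countable_of_separated hα hsep
    -- A point in no cell has a nearest point that is not unique, so it lies on one of countably
    -- many bisectors.
    have hsub : (⋃ γ : Γ, voronoiCell Γ γ)ᶜ ⊆
        ⋃ γ ∈ Γ, ⋃ γ' ∈ Γ, {z | γ ≠ γ' ∧ dist z γ = dist z γ'} := by
      intro z hz
      obtain ⟨γ, hγ, hmin⟩ := exists_nearest_point hα hsep hd z
      have h1 : z ∉ voronoiCell Γ γ := fun h => hz (Set.mem_iUnion.2 ⟨⟨γ, hγ⟩, h⟩)
      simp only [voronoiCell, Set.mem_ofPred_eq, not_forall, not_lt] at h1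
      obtain ⟨γ', hγ', hne, hle⟩ := h1
      exact Set.mem_iUnion₂.2 ⟨γ, hγ, Set.mem_iUnion₂.2
        ⟨γ', hγ', hne.symm, le_antisymm (hmin γ' hγ') hle⟩⟩
    refine measure_mono_null hsub ((measure_biUnion_null_iff hc).2 fun γ _ =>
      (measure_biUnion_null_iff hc).2 fun γ' _ => ?_)
    by_cases h : γ = γ'
    · simp [h]
    · exact measure_mono_null (fun z hz => hz.2) (volume_setOf_dist_eq h)
  ball_subset γ := ball_subset_voronoiCell hsep γ.2
  subset_ball γ := voronoiCell_subset_ball hd γ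

/-! ### The sampling operator and Schur's test -/

/-- The translated kernel difference `|k_{z-γ}(w-γ) - k(w-γ)|`. -/
noncomputable def kernelDifference (g : L2R) (γ z w : ℂ) : ℝ≥0∞ :=
  ‖gaborKernel g (z - γ) (w - γ) - gaborTransform g g (w - γ)‖ₑ

theorem measurable_kernelDifference (g : L2R) (γ : ℂ) :
    Measurable (Function.uncurry (kernelDifference g γ)) := by
  have h1 : Continuous fun p : ℂ × ℂ =>
      inner ℂ (gaborAtom g (p.2 - γ)) (gaborAtom g (p.1 - γ)) :=
    ((continuous_gaborAtom g).comp (continuous_snd.sub continuous_const)).inner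
      ((continuous_gaborAtom g).comp (continuous_fst.sub continuous_const))
  have h2 : Continuous fun p : ℂ × ℂ => gaborTransform g g (p.2 - γ) :=
    (continuous_gaborTransform g g).comp (continuous_snd.sub continuous_const)
  exact (h1.sub h2).measurable.enorm

theorem measurable_kernelDifference_right (g : L2R) (γ z : ℂ) :
    Measurable (kernelDifference g γ z) :=
  (measurable_kernelDifference g γ).of_uncurry_left

theorem measurable_kernelDifference_left (g : L2R) (γ w : ℂ) :
    Measurable fun z => kernelDifference g γ z w :=
  (measurable_kernelDifference g γ).of_uncurry_right

/-- The bound in `w` for Schur's test, by translation invariance. -/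
theorem lintegral_kernelDifference_le (g : L2R) {δ : ℝ} {γ z : ℂ} (hz : z ∈ ball γ δ) :
    ∫⁻ w, kernelDifference g γ z w ≤ kernelOscillation g δ := by
  have h1 : ∫⁻ w, kernelDifference g γ z w
      = ∫⁻ w, ‖gaborKernel g (z - γ) w - gaborTransform g g w‖ₑ :=
    lintegral_sub_right_eq_self
      (fun w => ‖gaborKernel g (z - γ) w - gaborTransform g g w‖ₑ) γ
  rw [h1]
  refine le_iSup₂ (f := fun z (_ : z ∈ closedBall (0 : ℂ) δ) =>
    ∫⁻ w, ‖gaborKernel g z w - gaborTransform g g w‖ₑ) (z - γ) ?_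
  rw [mem_closedBall_zero_iff, ← dist_eq_norm]
  exact (mem_ball.1 hz).le

/-- The majorant depends on `w - z` alone and no longer on `γ`, so integrals over different cells
can be joined. The maximal function absorbs the displacement `z - γ`. -/
theorem kernelDifference_le (g : L2R) {γ z : ℂ} (hz : z ∈ ball γ 1) (w : ℂ) :
    kernelDifference g γ z w ≤
      ‖gaborTransform g g (w - z)‖ₑ + localMaximal (gaborTransform g g) (w - z) := by
  refine enorm_sub_le.trans (add_le_add (le_of_eq ?_) (enorm_le_localMaximal ?_))
  · rw [gaborKernel, enorm_gaborTransform_gaborAtom, sub_sub_sub_cancel_right]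
  · rw [mem_ball, dist_eq_norm] at hz ⊢
    rwa [sub_sub_sub_cancel_left]

/-- The phase `p` is the one for which `p • g_z - g_γ` is the shift by `γ` of `g_{z-γ} - g`. The
reproducing formula and covariance then yield exactly the translated kernel difference. -/
theorem enorm_gaborTransform_sub_le {g : L2R} (hg : ‖g‖ = 1) (f : L2R) (γ z : ℂ) :
    ‖gaborTransform g f z - shiftPhase γ (z - γ) * gaborTransform g f γ‖ₑ ≤
      ∫⁻ w, kernelDifference g γ z w * ‖gaborTransform g f w‖ₑ := by
  set p := shiftPhase γ (z - γ) with hp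
  have hpp : p * (starRingEnd ℂ) p = 1 := by
    rw [Complex.mul_conj, Complex.normSq_eq_norm_sq, hp, norm_shiftPhase]
    simp
  have hD : gaborAtom (gaborAtom g (z - γ) - g) γ = p • gaborAtom g z - gaborAtom g γ := by
    rw [gaborAtom_sub, gaborAtom_gaborAtom, add_sub_cancel]
  have h1 : gaborTransform g f z - p * gaborTransform g f γ
      = p * inner ℂ (gaborAtom (gaborAtom g (z - γ) - g) γ) f := by
    rw [hD, inner_sub_left, inner_smul_left, mul_sub, ← mul_assoc, hpp, one_mul]
    rfl
  have hpe : ‖p‖ₑ = 1 := by rw [← ofReal_norm, hp, norm_shiftPhase, ENNReal.ofReal_one]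
  rw [h1, enorm_mul, hpe, one_mul, inner_eq_integral_gaborTransform hg]
  refine (enorm_integral_le_lintegral_enorm _).trans_eq (lintegral_congr fun w => ?_)
  rw [enorm_mul, RCLike.enorm_conj, enorm_gaborTransform_gaborAtom, kernelDifference,
    gaborKernel, gaborTransform, gaborTransform, gaborTransform, gaborTransform, inner_sub_right]

/-- The Cauchy–Schwarz inequality with a weight. -/
theorem lintegral_mul_sq_le {α : Type*} {m : MeasurableSpace α} {μ : Measure α}
    {κ u : α → ℝ≥0∞} (hκ : Measurable κ) (hu : Measurable u) :
    (∫⁻ x, κ x * u x ∂μ) ^ 2 ≤ (∫⁻ x, κ x ∂μ) * ∫⁻ x, κ x * u x ^ 2 ∂μ := by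
  have hroot : ∀ x : ℝ≥0∞, (x ^ (1 / 2 : ℝ)) ^ 2 = x := fun x => by
    rw [← ENNReal.rpow_natCast, ← ENNReal.rpow_mul]
    norm_num
  have h := ENNReal.lintegral_mul_le_Lp_mul_Lq μ (Real.HolderConjugate.two_two)
    (hκ.pow_const (1 / 2 : ℝ)).aemeasurable
    ((hκ.pow_const (1 / 2 : ℝ)).mul hu).aemeasurable
  have e1 : ∀ x, κ x ^ (1 / 2 : ℝ) * (κ x ^ (1 / 2 : ℝ) * u x) = κ x * u x := fun x => by
    rw [← mul_assoc, ← sq, hroot]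
  simp only [Pi.mul_apply, e1, ENNReal.rpow_two, mul_pow, hroot] at h
  calc (∫⁻ x, κ x * u x ∂μ) ^ 2 ≤ _ := pow_le_pow_left' h 2
    _ = _ := by rw [mul_pow, hroot, hroot]

theorem enorm_gaborTransform_sub_sq_le {g : L2R} (hg : ‖g‖ = 1) (f : L2R) {δ : ℝ} {γ z : ℂ}
    (hz : z ∈ ball γ δ) :
    ‖gaborTransform g f z - shiftPhase γ (z - γ) * gaborTransform g f γ‖ₑ ^ 2 ≤
      kernelOscillation g δ *
        ∫⁻ w, kernelDifference g γ z w * ‖gaborTransform g f w‖ₑ ^ 2 :=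
  (pow_le_pow_left' (enorm_gaborTransform_sub_le hg f γ z) 2).trans
    ((lintegral_mul_sq_le (measurable_kernelDifference_right g γ z)
      (continuous_gaborTransform g f).measurable.enorm).trans
      (mul_le_mul_left (lintegral_kernelDifference_le g hz) _))

theorem deviation_lt_one {g : L2R} {δ : ℝ} (hq : deviationSq g δ < 1) : deviation g δ < 1 := by
  rw [deviation, Real.sqrt_lt' one_pos, one_pow]
  exact ENNReal.toReal_lt_of_lt_ofReal (by simpa using hq)

section Cells

variable {Γ : Set ℂ} {α δ : ℝ} {V : Γ → Set ℂ}

theorem IsCellPartition.lintegral_eq_tsum [Countable Γ] (hV : IsCellPartition Γ α δ V)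
    (u : ℂ → ℝ≥0∞) : ∫⁻ z, u z = ∑' γ, ∫⁻ z in V γ, u z := by
  rw [← lintegral_iUnion (fun γ => (hV.isOpen γ).measurableSet) (fun _ _ h => hV.disjoint _ _ h),
    Measure.restrict_eq_self_of_ae_mem]
  rw [ae_iff]
  exact hV.null_compl

theorem tsum_setLIntegral_kernelDifference_le [Countable Γ] (hV : IsCellPartition Γ α δ V)
    (hδ : δ ≤ 1) (g : L2R) (w : ℂ) :
    ∑' γ, ∫⁻ z in V γ, kernelDifference g γ z w ≤
      (∫⁻ w, ‖gaborTransform g g w‖ₑ) + ∫⁻ w, localMaximal (gaborTransform g g) w := by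
  calc ∑' γ, ∫⁻ z in V γ, kernelDifference g γ z w
      ≤ ∑' γ, ∫⁻ z in V γ,
          (‖gaborTransform g g (w - z)‖ₑ + localMaximal (gaborTransform g g) (w - z)) :=
        ENNReal.tsum_le_tsum fun γ => setLIntegral_mono' (hV.isOpen γ).measurableSet fun z hz =>
          kernelDifference_le g (ball_subset_ball hδ (hV.subset_ball γ hz)) w
    _ = ∫⁻ z, (‖gaborTransform g g (w - z)‖ₑ + localMaximal (gaborTransform g g) (w - z)) :=
        (hV.lintegral_eq_tsum _).symm
    _ = ∫⁻ z, (‖gaborTransform g g z‖ₑ + localMaximal (gaborTransform g g) z) :=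
        lintegral_sub_left_eq_self
          (fun z => ‖gaborTransform g g z‖ₑ + localMaximal (gaborTransform g g) z) w
    _ = _ := lintegral_add_left (continuous_gaborTransform g g).measurable.enorm _

/-- Schur's test for the difference between a function of the model space and its samples. -/
theorem tsum_setLIntegral_sub_sq_le [Countable Γ] (hV : IsCellPartition Γ α δ V) (hδ : δ ≤ 1)
    {g : L2R} (hg : ‖g‖ = 1) (f : L2R) :
    ∑' γ : Γ, ∫⁻ z in V γ,
        ‖gaborTransform g f z - shiftPhase γ (z - γ) * gaborTransform g f γ‖ₑ ^ 2 ≤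
      deviationSq g δ * ‖f‖ₑ ^ 2 := by
  have hg' : ‖g‖ₑ = 1 := by rw [← ofReal_norm, hg, ENNReal.ofReal_one]
  have hFm : Measurable fun w => ‖gaborTransform g f w‖ₑ ^ 2 :=
    (continuous_gaborTransform g f).measurable.enorm.pow_const 2
  have hkm : ∀ γ : ℂ, Measurable fun p : ℂ × ℂ =>
      kernelDifference g γ p.1 p.2 * ‖gaborTransform g f p.2‖ₑ ^ 2 := fun γ =>
    (measurable_kernelDifference g γ).mul (hFm.comp measurable_snd)
  have hin : ∀ γ : Γ, Measurable fun w => ∫⁻ z in V γ, kernelDifference g γ z w := fun γ =>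
    (measurable_kernelDifference g γ).lintegral_prod_left'
  have hprod : ∀ γ : Γ, AEMeasurable (fun w =>
      (∫⁻ z in V γ, kernelDifference g γ z w) * ‖gaborTransform g f w‖ₑ ^ 2) volume := fun γ =>
    ((hin γ).mul hFm).aemeasurable
  -- The bound in `w` is spent here, cell by cell; Tonelli leaves the `z`-integral inside, ready for
  -- summation over the cells.
  have hone : ∀ γ : Γ, ∫⁻ z in V γ,
        ‖gaborTransform g f z - shiftPhase γ (z - γ) * gaborTransform g f γ‖ₑ ^ 2 ≤
      kernelOscillation g δ * ∫⁻ w, (∫⁻ z in V γ, kernelDifference g γ z w) *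
        ‖gaborTransform g f w‖ₑ ^ 2 := by
    intro γ
    calc _ ≤ ∫⁻ z in V γ, kernelOscillation g δ *
          ∫⁻ w, kernelDifference g γ z w * ‖gaborTransform g f w‖ₑ ^ 2 :=
          setLIntegral_mono' (hV.isOpen γ).measurableSet fun z hz =>
            enorm_gaborTransform_sub_sq_le hg f (hV.subset_ball γ hz)
      _ = kernelOscillation g δ * ∫⁻ z in V γ,
          ∫⁻ w, kernelDifference g γ z w * ‖gaborTransform g f w‖ₑ ^ 2 :=
          lintegral_const_mul _ (hkm γ).lintegral_prod_right'
      _ = _ := by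
          rw [lintegral_lintegral_swap
            (f := fun z w => kernelDifference g γ z w * ‖gaborTransform g f w‖ₑ ^ 2)
            (hkm γ).aemeasurable]
          congr 1
          exact lintegral_congr fun w => lintegral_mul_const _ (measurable_kernelDifference_left g γ w)
  calc _ ≤ ∑' γ : Γ, kernelOscillation g δ * ∫⁻ w, (∫⁻ z in V γ, kernelDifference g γ z w) *
        ‖gaborTransform g f w‖ₑ ^ 2 := ENNReal.tsum_le_tsum hone
    _ = kernelOscillation g δ * ∫⁻ w, (∑' γ : Γ, ∫⁻ z in V γ, kernelDifference g γ z w) *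
        ‖gaborTransform g f w‖ₑ ^ 2 := by
        rw [ENNReal.tsum_mul_left]
        simp_rw [← ENNReal.tsum_mul_right]
        rw [lintegral_tsum hprod]
    _ ≤ kernelOscillation g δ * ∫⁻ w,
        ((∫⁻ w, ‖gaborTransform g g w‖ₑ) + ∫⁻ w, localMaximal (gaborTransform g g) w) *
        ‖gaborTransform g f w‖ₑ ^ 2 := by
        gcongr with w
        exact tsum_setLIntegral_kernelDifference_le hV hδ g w
    _ = _ := by
        rw [lintegral_const_mul _ hFm, lintegral_gaborTransform_sq, hg', one_pow, one_mul,
          ← mul_assoc, deviationSq]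

theorem IsCellPartition.aestronglyMeasurable [Countable Γ] (hV : IsCellPartition Γ α δ V)
    {E : ℂ → ℂ} {e : Γ → ℂ → ℂ} (he : ∀ γ, Continuous (e γ))
    (h : ∀ γ, ∀ z ∈ V γ, E z = e γ z) : AEStronglyMeasurable E volume := by
  have h1 : volume.restrict (⋃ γ, V γ) = (volume : Measure ℂ) :=
    Measure.restrict_eq_self_of_ae_mem (by rw [ae_iff]; exact hV.null_compl)
  rw [← h1, aestronglyMeasurable_iUnion_iff]
  intro γ
  refine (he γ).aestronglyMeasurable.congr ?_
  filter_upwards [ae_restrict_mem (hV.isOpen γ).measurableSet] with z hz using (h γ z hz).symm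

/-- Disjointness makes the prescriptions compatible; the value off the cells does not matter for
integrals, the remainder being null. -/
theorem IsCellPartition.exists_glue (hV : IsCellPartition Γ α δ V) (e : Γ → ℂ → ℂ) :
    ∃ E : ℂ → ℂ, ∀ γ, ∀ z ∈ V γ, E z = e γ z := by
  have : ∀ z, ∃ a : ℂ, ∀ γ, z ∈ V γ → a = e γ z := by
    intro z
    by_cases h : ∃ γ, z ∈ V γ
    · obtain ⟨γ, hγ⟩ := h
      refine ⟨e γ z, fun γ' hγ' => ?_⟩
      by_cases hne : γ = γ'
      · rw [hne]
      · exact (Set.disjoint_left.1 (hV.disjoint γ γ' hne) hγ hγ').elim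
    · exact ⟨0, fun γ hγ => (h ⟨γ, hγ⟩).elim⟩
  choose E hE using this
  exact ⟨E, fun γ z hz => hE z γ hz⟩

theorem weighted_sampling_bounds [Countable Γ] (hV : IsCellPartition Γ α δ V) (hδ : δ ≤ 1)
    {g : L2R} (hg : ‖g‖ = 1) (hq : deviationSq g δ < 1) (f : L2R) :
    Summable (fun γ : Γ => (volume (V γ)).toReal * ‖gaborTransform g f γ‖ ^ 2) ∧
    (1 - deviation g δ) ^ 2 * ‖f‖ ^ 2
      ≤ ∑' γ : Γ, (volume (V γ)).toReal * ‖gaborTransform g f γ‖ ^ 2 ∧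
    ∑' γ : Γ, (volume (V γ)).toReal * ‖gaborTransform g f γ‖ ^ 2
      ≤ (1 + deviation g δ) ^ 2 * ‖f‖ ^ 2 := by
  have hg' : ‖g‖ₑ = 1 := by rw [← ofReal_norm, hg, ENNReal.ofReal_one]
  set F := gaborTransform g f with hF
  set e : Γ → ℂ → ℂ := fun γ z => shiftPhase γ (z - γ) * F γ with he
  have hec : ∀ γ, Continuous (e γ) := fun γ => by
    simp only [he, shiftPhase]
    have : Continuous fun z : ℂ => (((z - γ).im : ℝ) : ℂ) :=
      Complex.continuous_ofReal.comp
        (Complex.continuous_im.comp (continuous_id.sub continuous_const))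
    fun_prop
  obtain ⟨E, hE⟩ := hV.exists_glue e
  have hEm : AEStronglyMeasurable E volume := hV.aestronglyMeasurable hec hE
  have hFm : AEStronglyMeasurable F volume := (continuous_gaborTransform g f).aestronglyMeasurable
  have hFn : eLpNorm F 2 volume ^ 2 = ‖f‖ₑ ^ 2 := by
    rw [← lintegral_enorm_sq_eq, lintegral_gaborTransform_sq, hg', one_pow, one_mul]
  -- The phases have modulus one, so `‖E z‖` is constant on each cell.
  have hEn : eLpNorm E 2 volume ^ 2 = ∑' γ : Γ, volume (V γ) * ‖F γ‖ₑ ^ 2 := by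
    rw [← lintegral_enorm_sq_eq, hV.lintegral_eq_tsum]
    refine tsum_congr fun γ => ?_
    rw [mul_comm, ← setLIntegral_const]
    refine setLIntegral_congr_fun (hV.isOpen γ).measurableSet fun z hz => ?_
    rw [hE γ z hz, he]
    simp only [enorm_mul]
    rw [← ofReal_norm (shiftPhase _ _), norm_shiftPhase, ENNReal.ofReal_one, one_mul]
  have hDn : eLpNorm (F - E) 2 volume ^ 2 ≤ deviationSq g δ * ‖f‖ₑ ^ 2 := by
    rw [← lintegral_enorm_sq_eq, hV.lintegral_eq_tsum]
    refine le_trans (le_of_eq (tsum_congr fun γ => ?_)) (tsum_setLIntegral_sub_sq_le hV hδ hg f)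
    refine setLIntegral_congr_fun (hV.isOpen γ).measurableSet fun z hz => ?_
    rw [Pi.sub_apply, hE γ z hz]
  have hFfin : eLpNorm F 2 volume ≠ ∞ := (memLp_gaborTransform g f).2.ne
  have hDfin : eLpNorm (F - E) 2 volume ≠ ∞ := by
    intro h
    rw [h] at hDn
    have : deviationSq g δ * ‖f‖ₑ ^ 2 ≠ ∞ := by finiteness [hq.ne_top]
    exact this (top_le_iff.1 (by simpa using hDn))
  -- Both bounds are triangle inequalities for `F`, `E` and `F - E`; this one also shows that `E`
  -- has finite norm, hence that the weighted series is summable.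
  have hle1 : eLpNorm E 2 volume ≤ eLpNorm F 2 volume + eLpNorm (F - E) 2 volume := by
    have := eLpNorm_sub_le (p := 2) hFm (hFm.sub hEm) (by norm_num)
    rwa [sub_sub_cancel] at this
  have hle2 : eLpNorm F 2 volume ≤ eLpNorm (F - E) 2 volume + eLpNorm E 2 volume := by
    have := eLpNorm_add_le (p := 2) (hFm.sub hEm) hEm (by norm_num)
    rwa [sub_add_cancel] at this
  have hEfin : eLpNorm E 2 volume ≠ ∞ := (hle1.trans_lt (by finiteness)).ne
  have hterm : ∀ γ : Γ, (volume (V γ) * ‖F γ‖ₑ ^ 2).toReal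
      = (volume (V γ)).toReal * ‖F γ‖ ^ 2 := fun γ => by
    rw [ENNReal.toReal_mul, ENNReal.toReal_pow, toReal_enorm]
  have htsum : ∑' γ : Γ, volume (V γ) * ‖F γ‖ₑ ^ 2 ≠ ∞ := by
    rw [← hEn]
    finiteness
  have hsum := ENNReal.summable_toReal htsum
  simp_rw [hterm] at hsum
  have hval : ∑' γ : Γ, (volume (V γ)).toReal * ‖F γ‖ ^ 2 = (eLpNorm E 2 volume).toReal ^ 2 := by
    rw [← ENNReal.toReal_pow, hEn,
      ENNReal.tsum_toReal_eq fun γ => ENNReal.ne_top_of_tsum_ne_top htsum γ]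
    simp_rw [hterm]
  have hN : (eLpNorm F 2 volume).toReal = ‖f‖ := by
    rw [(ENNReal.pow_right_strictMono two_ne_zero).injective hFn, toReal_enorm]
  have hD : (eLpNorm (F - E) 2 volume).toReal ≤ deviation g δ * ‖f‖ := by
    rw [deviation, ← Real.sqrt_sq (norm_nonneg f), ← Real.sqrt_mul ENNReal.toReal_nonneg]
    refine Real.le_sqrt_of_sq_le ?_
    have := ENNReal.toReal_mono (by finiteness [hq.ne_top]) hDn
    rwa [ENNReal.toReal_pow, ENNReal.toReal_mul, ENNReal.toReal_pow, toReal_enorm] at this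
  have hq1 := deviation_lt_one hq
  have h1 := ENNReal.toReal_mono (by finiteness) hle1
  have h2 := ENNReal.toReal_mono (by finiteness) hle2
  rw [ENNReal.toReal_add (by finiteness) (by finiteness), hN] at h1 h2
  refine ⟨hsum, ?_, ?_⟩
  · rw [hval, ← mul_pow]
    refine pow_le_pow_left₀ (mul_nonneg (by linarith) (norm_nonneg _)) ?_ 2
    linarith
  · rw [hval, ← mul_pow]
    refine pow_le_pow_left₀ ENNReal.toReal_nonneg ?_ 2
    linarith

end Cells

/-! ### Sampling theorems -/

theorem toReal_volume_ball (z : ℂ) {r : ℝ} (hr : 0 ≤ r) :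
    (volume (ball z r)).toReal = Real.pi * r ^ 2 := by
  rw [Complex.volume_ball, ENNReal.toReal_mul, ENNReal.toReal_pow, ENNReal.toReal_ofReal hr,
    ENNReal.coe_toReal, NNReal.coe_real_pi, mul_comm]

theorem unweighted_sampling_bounds {Γ : Set ℂ} {α δ : ℝ} (hα : 0 < α)
    (hsep : ∀ z ∈ Γ, ∀ w ∈ Γ, z ≠ w → α ≤ ‖z - w‖)
    (hd : ∀ z : ℂ, (ball z δ ∩ Γ).Nonempty) (hδ0 : 0 < δ) (hδ : δ ≤ 1)
    {g : L2R} (hg : ‖g‖ = 1) (hq : deviationSq g δ < 1) (f : L2R) :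
    Summable (fun γ : Γ => ‖gaborTransform g f γ‖ ^ 2) ∧
    (1 - deviation g δ) ^ 2 / (Real.pi * δ ^ 2) * ‖f‖ ^ 2
      ≤ ∑' γ : Γ, ‖gaborTransform g f γ‖ ^ 2 ∧
    ∑' γ : Γ, ‖gaborTransform g f γ‖ ^ 2
      ≤ (1 + deviation g δ) ^ 2 / (Real.pi * (α / 2) ^ 2) * ‖f‖ ^ 2 := by
  have : Countable Γ := (countable_of_separated hα hsep).to_subtype
  have hV := isCellPartition_voronoiCell hα hsep hd
  obtain ⟨h1, h2, h3⟩ := weighted_sampling_bounds hV hδ hg hq f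
  have hup : ∀ γ : Γ, (volume (voronoiCell Γ γ)).toReal ≤ Real.pi * δ ^ 2 := fun γ => by
    rw [← toReal_volume_ball γ hδ0.le]
    exact ENNReal.toReal_mono measure_ball_lt_top.ne (measure_mono (hV.subset_ball γ))
  have hlo : ∀ γ : Γ, Real.pi * (α / 2) ^ 2 ≤ (volume (voronoiCell Γ γ)).toReal := fun γ => by
    rw [← toReal_volume_ball γ (by positivity)]
    exact ENNReal.toReal_mono
      ((measure_mono (hV.subset_ball γ)).trans_lt measure_ball_lt_top).ne
      (measure_mono (hV.ball_subset γ))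
  -- The lower bound on the cell areas transfers summability from the weighted to the unweighted
  -- series.
  have hsum' : Summable fun γ : Γ => Real.pi * (α / 2) ^ 2 * ‖gaborTransform g f γ‖ ^ 2 :=
    h1.of_nonneg_of_le (fun γ => by positivity)
      fun γ => mul_le_mul_of_nonneg_right (hlo γ) (by positivity)
  have hpos : 0 < Real.pi * (α / 2) ^ 2 := by positivity
  have hsum : Summable fun γ : Γ => ‖gaborTransform g f γ‖ ^ 2 :=
    (summable_mul_left_iff hpos.ne').1 hsum'
  refine ⟨hsum, ?_, ?_⟩
  · rw [div_mul_eq_mul_div, div_le_iff₀ (by positivity), mul_comm (∑' _, _), ← tsum_mul_left]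
    exact h2.trans (h1.tsum_le_tsum
      (fun γ => mul_le_mul_of_nonneg_right (hup γ) (by positivity)) (hsum.mul_left _))
  · rw [div_mul_eq_mul_div, le_div_iff₀ hpos, mul_comm (∑' _, _), ← tsum_mul_left]
    exact (hsum'.tsum_le_tsum
      (fun γ => mul_le_mul_of_nonneg_right (hlo γ) (by positivity)) h1).trans h3

theorem mem_modelSpace {g : L2R} {F : ℂ → ℂ} (hF : F ∈ modelSpace g) :
    ∃ f : L2R, F = gaborTransform g f :=
  let ⟨_, f, hf⟩ := hF
  ⟨f, funext hf⟩

theorem mainTheorem4 (g : L2R) (hg : ‖g‖ = 1) (hA : g ∈ feichtingerAlgebra) :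
    -- sufficiently dense uniformly discrete sets are sampling sets and give frames
    (∃ δ : ℝ, 0 < δ ∧ ∀ Γ : Set ℂ, IsUniformlyDiscrete Γ →
      (∀ z : ℂ, (Metric.ball z δ ∩ Γ).Nonempty) →
      IsSamplingSet g Γ ∧ IsHilbertFrame (gaborSystem g Γ)) ∧
    -- the explicit form: which `δ` are admissible, and with which bounds
    (∃ δ : ℝ, 0 < δ ∧ δ ≤ 1 ∧ deviationSq g δ < 1) ∧
    (∀ δ : ℝ, 0 < δ → δ ≤ 1 → deviationSq g δ < 1 →
      ∀ (Γ : Set ℂ) (α : ℝ), 0 < α → (∀ z ∈ Γ, ∀ w ∈ Γ, z ≠ w → α ≤ ‖z - w‖) →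
      (∀ z : ℂ, (Metric.ball z δ ∩ Γ).Nonempty) →
      (∃ V : Γ → Set ℂ, IsCellPartition Γ α δ V) ∧
      (∀ V : Γ → Set ℂ, IsCellPartition Γ α δ V → ∀ F ∈ modelSpace g,
        Summable (fun γ : Γ => (MeasureTheory.volume (V γ)).toReal * ‖F γ‖ ^ 2) ∧
        (1 - deviation g δ) ^ 2 * normSqL2 F
          ≤ ∑' γ : Γ, (MeasureTheory.volume (V γ)).toReal * ‖F γ‖ ^ 2 ∧
        ∑' γ : Γ, (MeasureTheory.volume (V γ)).toReal * ‖F γ‖ ^ 2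
          ≤ (1 + deviation g δ) ^ 2 * normSqL2 F) ∧
      (∀ F ∈ modelSpace g,
        Summable (fun γ : Γ => ‖F γ‖ ^ 2) ∧
        (1 - deviation g δ) ^ 2 / (Real.pi * δ ^ 2) * normSqL2 F ≤ ∑' γ : Γ, ‖F γ‖ ^ 2 ∧
        ∑' γ : Γ, ‖F γ‖ ^ 2
          ≤ (1 + deviation g δ) ^ 2 / (Real.pi * (α / 2) ^ 2) * normSqL2 F)) := by
  refine ⟨?_, exists_deviationSq_lt_one hg hA, ?_⟩
  · obtain ⟨δ, hδ0, hδ, hq⟩ := exists_deviationSq_lt_one hg hA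
    refine ⟨δ, hδ0, fun Γ ⟨α, hα, hsep⟩ hd => ?_⟩
    have hb := unweighted_sampling_bounds hα (fun z hz w hw hne => (hsep z hz w hw hne).le)
      hd hδ0 hδ hg hq
    have hq1 := deviation_lt_one hq
    have hq0 : 0 ≤ deviation g δ := Real.sqrt_nonneg _
    have hA0 : 0 < (1 - deviation g δ) ^ 2 / (Real.pi * δ ^ 2) := by
      have : 0 < 1 - deviation g δ := sub_pos.2 hq1
      positivity
    have hB0 : 0 < (1 + deviation g δ) ^ 2 / (Real.pi * (α / 2) ^ 2) := by positivity
    -- Since the transform is isometric, the sampling inequality and the frame inequality are the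
    -- same statement with the same constants.
    refine ⟨⟨_, _, hA0, hB0, fun F hF => ?_⟩, ⟨_, _, hA0, hB0, hb⟩⟩
    obtain ⟨f, rfl⟩ := mem_modelSpace hF
    rw [normSqL2_gaborTransform hg]
    exact hb f
  · intro δ hδ0 hδ hq Γ α hα hsep hd
    have : Countable Γ := (countable_of_separated hα hsep).to_subtype
    refine ⟨⟨_, isCellPartition_voronoiCell hα hsep hd⟩, fun V hV F hF => ?_, fun F hF => ?_⟩
    · obtain ⟨f, rfl⟩ := mem_modelSpace hF
      rw [normSqL2_gaborTransform hg]
      exact weighted_sampling_bounds hV hδ hg hq f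
    · obtain ⟨f, rfl⟩ := mem_modelSpace hF
      rw [normSqL2_gaborTransform hg]
      exact unweighted_sampling_bounds hα hsep hd hδ0 hδ hg hq f
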